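/- Let $G$ be a finite simple connected $k$-regular graph with at least two vertices, and let $g$ be its girth, that is, the length of a shortest cycle ($g=\infty$ if $G$ has no cycle). Suppose that the adjacency matrix of $G$ has exactly $d+1$ distinct eigenvalues. If $g \ge 2d$, then $G$ is an extremal expander: its second-largest adjacency eigenvalue, where eigenvalues are counted with multiplicity, is the minimum of the second-largest adjacency eigenvalues of all $k$-regular simple graphs (connected or not) with the same number of vertices as $G$. -/

import Mathlib

/-- The second-largest adjacency eigenvalue of a finite simple graph with at least two vertices.
Eigenvalues are counted with multiplicity: `eigenvalues₀` lists them in nonincreasing order,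
indexed from `0`, and this is the entry of index `1`. -/
noncomputable def SimpleGraph.secondLargestEigenvalue {V : Type*} [Fintype V] [DecidableEq V]
    [Nontrivial V] (G : SimpleGraph V) [DecidableRel G.Adj] : ℝ :=
  (G.isHermitian_adjMatrix ℝ).eigenvalues₀ ⟨1, Fintype.one_lt_card⟩

universe u w

/-- `G` is an extremal expander of degree `k`: it is `k`-regular, and its second-largest eigenvalue
is the minimum over all `k`-regular graphs (connected or not) with as many vertices as `G`. -/
def SimpleGraph.IsExtremalExpander {V : Type u} [Fintype V] [DecidableEq V] [Nontrivial V]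
    (G : SimpleGraph V) [DecidableRel G.Adj] (k : ℕ) : Prop :=
  G.IsRegularOfDegree k ∧
    ∀ (W : Type w) [Fintype W] [DecidableEq W] [Nontrivial W] (H : SimpleGraph W)
      [DecidableRel H.Adj], Fintype.card W = Fintype.card V → H.IsRegularOfDegree k →
        G.secondLargestEigenvalue ≤ H.secondLargestEigenvalue

/-! This is a linear programming argument. Let `F i = nbPoly k i`: at the adjacency matrix of any
`k`-regular graph it counts non-backtracking walks of length `i`. The trace of `F i * F j` depends
on the graph, but girth at least `2 * d` makes it as small as possible for `i ≤ d`, `j < d`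
(`trace_aeval_mul_le`).

Let `t` be the second eigenvalue of `G`, `p` the monic polynomial whose roots are the eigenvalues
other than `k`, and `q = p / (X - t)`. The Hoffman identity and the girth give `p = F d + c * (F 0 +
... + F (d - 1))` with `c ≥ 0`; Christoffel–Darboux then makes `q` a nonnegative combination of the
`F i` with `i < d`.

If some `H` had second eigenvalue `r < t`, compare the traces of `(X - r) * q ^ 2 = (p + (t - r) *
q) * q`. The trace for `G` is at most that for `H`. But in `H` only one eigenvalue `k` can
contribute positively, while in `G` the same contribution is joined by a positive one from `t`: a
contradiction. -/

namespace SimpleGraph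

open Finset Polynomial Matrix

/-! ### Uniqueness of short non-backtracking walks. -/

section Girth

variable {V : Type*}

/-- Two non-backtracking walks between the same endpoints whose total length is less than the girth
are equal. -/
theorem Walk.eq_of_isChain_edges_of_length_lt_egirth {G : SimpleGraph V} {u v : V}
    (p q : G.Walk u v) (hp : p.edges.IsChain (· ≠ ·)) (hq : q.edges.IsChain (· ≠ ·))
    (h : ((p.length + q.length : ℕ) : ℕ∞) < G.egirth) : p = q := by
  classical
  set S : Finset (Sym2 V) := p.edges.toFinset ∪ q.edges.toFinset with hS
  set H : SimpleGraph V := fromEdgeSet (S : Set (Sym2 V)) with hH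
  have hSG : ∀ e ∈ S, e ∈ G.edgeSet := by
    intro e he
    simp only [hS, Finset.mem_union, List.mem_toFinset] at he
    exact he.elim (fun h => p.edges_subset_edgeSet h) (fun h => q.edges_subset_edgeSet h)
  have hSH : ∀ e ∈ S, e ∈ H.edgeSet := by
    intro e he
    rw [hH, edgeSet_fromEdgeSet]
    exact ⟨he, G.not_isDiag_of_mem_edgeSet (hSG e he)⟩
  have hHS : ∀ e ∈ H.edgeSet, e ∈ S := by
    intro e he
    rw [hH, edgeSet_fromEdgeSet] at he
    exact he.1
  -- A cycle in the union of the two walks would have at most `p.length + q.length` edges, fewer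
  -- than the girth.
  have hac : H.IsAcyclic := by
    intro a c hc
    have hcG : ∀ e ∈ c.edges, e ∈ G.edgeSet := fun e he =>
      hSG e (hHS e (c.edges_subset_edgeSet he))
    have h1 := egirth_le_length (hc.transfer hcG)
    rw [Walk.length_transfer] at h1
    have h2 : c.length ≤ p.length + q.length := by
      rw [← c.length_edges, ← List.toFinset_card_of_nodup hc.isTrail.edges_nodup]
      calc c.edges.toFinset.card ≤ S.card := Finset.card_le_card fun e he =>
            hHS e (c.edges_subset_edgeSet (List.mem_toFinset.1 he))
        _ ≤ p.edges.toFinset.card + q.edges.toFinset.card := Finset.card_union_le _ _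
        _ ≤ p.edges.length + q.edges.length :=
            Nat.add_le_add (List.toFinset_card_le _) (List.toFinset_card_le _)
        _ = _ := by simp
    exact absurd (lt_of_le_of_lt (Nat.cast_le.2 h2) h) (not_lt.2 h1)
  have hpH : ∀ e ∈ p.edges, e ∈ H.edgeSet := fun e he => hSH e (by simp [hS, he])
  have hqH : ∀ e ∈ q.edges, e ∈ H.edgeSet := fun e he => hSH e (by simp [hS, he])
  have e1 : (p.transfer H hpH).IsPath := (hac.isPath_iff_isChain _).2 (by simpa using hp)
  have e2 : (q.transfer H hqH).IsPath := (hac.isPath_iff_isChain _).2 (by simpa using hq)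
  have e3 := congrArg Subtype.val ((hac.subsingleton_path u v).elim ⟨_, e1⟩ ⟨_, e2⟩)
  apply Walk.ext_support
  have := congrArg Walk.support e3
  simpa using this

end Girth

/-! ### Counting non-backtracking walks. -/

section NonBacktracking

variable {V : Type*} [Fintype V] [DecidableEq V] (G : SimpleGraph V) [DecidableRel G.Adj]

/-- The number of non-backtracking walks of length `i + 1` from `u` to `y` with first step
`u → v`. -/
def nbDartCount : ℕ → V → V → V → ℕ
  | 0, u, v, y => if G.Adj u v ∧ v = y then 1 else 0
  | i + 1, u, v, y => if G.Adj u v then ∑ z with z ≠ u, nbDartCount i v z y else 0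

/-- The number of non-backtracking walks of length `i` from `u` to `y`. -/
def nbCount : ℕ → V → V → ℕ
  | 0, u, y => if u = y then 1 else 0
  | i + 1, u, y => ∑ v, G.nbDartCount i u v y

variable {G}

theorem adj_of_nbDartCount_ne_zero {i : ℕ} {u v y : V} (h : G.nbDartCount i u v y ≠ 0) :
    G.Adj u v := by
  by_contra hn
  cases i <;> simp [nbDartCount, hn] at h

theorem exists_walk_of_nbDartCount_ne_zero {i : ℕ} {u v y : V} (h : G.nbDartCount i u v y ≠ 0) :
    ∃ (huv : G.Adj u v) (p : G.Walk v y), p.length = i ∧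
      (Walk.cons huv p).edges.IsChain (· ≠ ·) := by
  induction i generalizing u v with
  | zero =>
    have huv := adj_of_nbDartCount_ne_zero h
    have : v = y := by by_contra hn; simp [nbDartCount, hn] at h
    subst this
    exact ⟨huv, Walk.nil, rfl, by simp⟩
  | succ i ih =>
    have huv := adj_of_nbDartCount_ne_zero h
    simp only [nbDartCount, if_pos huv] at h
    obtain ⟨z, hz, hz'⟩ := Finset.exists_ne_zero_of_sum_ne_zero h
    obtain ⟨hvz, p, hp, hc⟩ := ih hz'
    refine ⟨huv, Walk.cons hvz p, by simp [hp], ?_⟩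
    rw [Walk.edges_cons] at hc
    rw [Walk.edges_cons, Walk.edges_cons, List.isChain_cons_cons]
    refine ⟨?_, hc⟩
    have hzu : z ≠ u := by simpa using hz
    intro he
    rcases Sym2.eq_iff.1 he with ⟨h1, h2⟩ | ⟨h1, h2⟩
    · exact huv.ne h1
    · exact hzu h1.symm

theorem exists_walk_of_nbCount_ne_zero {i : ℕ} {u y : V} (h : G.nbCount i u y ≠ 0) :
    ∃ p : G.Walk u y, p.length = i ∧ p.edges.IsChain (· ≠ ·) := by
  cases i with
  | zero =>
    have : u = y := by by_contra hn; simp [nbCount, hn] at h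
    subst this
    exact ⟨Walk.nil, rfl, by simp⟩
  | succ i =>
    obtain ⟨v, -, hv⟩ := Finset.exists_ne_zero_of_sum_ne_zero h
    obtain ⟨huv, p, hp, hc⟩ := exists_walk_of_nbDartCount_ne_zero hv
    exact ⟨Walk.cons huv p, by simp [hp], hc⟩

theorem nbCount_eq_zero_of_ne_of_lt_egirth {i j : ℕ} (hij : i ≠ j)
    (h : ((i + j : ℕ) : ℕ∞) < G.egirth) {u y : V} (hi : G.nbCount i u y ≠ 0) :
    G.nbCount j u y = 0 := by
  by_contra hj
  obtain ⟨p, hp, hpc⟩ := exists_walk_of_nbCount_ne_zero hi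
  obtain ⟨q, hq, hqc⟩ := exists_walk_of_nbCount_ne_zero hj
  have := Walk.eq_of_isChain_edges_of_length_lt_egirth p q hpc hqc (by rwa [hp, hq])
  exact hij (by rw [← hp, ← hq, this])

/-- The first step is forced by uniqueness of short walks, the rest by induction. -/
theorem nbCount_le_one_of_lt_egirth {i : ℕ} (h : ((2 * i : ℕ) : ℕ∞) < G.egirth) (u y : V) :
    G.nbCount i u y ≤ 1 := by
  induction i generalizing u with
  | zero => simp only [nbCount]; split_ifs <;> simp
  | succ i ih =>
    have ih' : ∀ v, G.nbCount i v y ≤ 1 :=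
      ih (lt_of_le_of_lt (Nat.cast_le.2 (by omega)) h)
    have hd : ∀ v, G.nbDartCount i u v y ≤ 1 := by
      intro v
      cases i with
      | zero => simp only [nbDartCount]; split_ifs <;> simp
      | succ i =>
        simp only [nbDartCount]
        split_ifs
        · exact (Finset.sum_le_sum_of_subset (Finset.filter_subset _ _)).trans (ih' v)
        · simp
    by_cases h0 : G.nbCount (i + 1) u y = 0
    · omega
    · obtain ⟨v, -, hv⟩ := Finset.exists_ne_zero_of_sum_ne_zero h0
      have : G.nbCount (i + 1) u y = G.nbDartCount i u v y := by
        refine Finset.sum_eq_single v (fun w _ hw => ?_) (by simp)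
        by_contra hw0
        obtain ⟨huv, p, hp, hpc⟩ := exists_walk_of_nbDartCount_ne_zero hv
        obtain ⟨huw, q, hq, hqc⟩ := exists_walk_of_nbDartCount_ne_zero hw0
        have := Walk.eq_of_isChain_edges_of_length_lt_egirth _ _ hpc hqc
          (by rw [Walk.length_cons, Walk.length_cons, hp, hq]
              convert h using 2
              ring)
        exact hw (by simpa using (congrArg Walk.snd this).symm)
      rw [this]
      exact hd v

theorem sum_nbDartCount_reverse_zero {k : ℕ} (hreg : G.IsRegularOfDegree k) (v y : V) :
    ∑ u with G.Adj v u, G.nbDartCount 0 u v y = k * G.nbCount 0 v y := by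
  have : ∀ u ∈ univ.filter (G.Adj v), G.nbDartCount 0 u v y = G.nbCount 0 v y := by
    intro u hu
    have hu : G.Adj v u := by simpa using hu
    simp [nbDartCount, nbCount, hu.symm]
  rw [Finset.sum_congr rfl this, Finset.sum_const, ← neighborFinset_eq_filter,
    card_neighborFinset_eq_degree, hreg v, smul_eq_mul]

/-- A walk from `v` with first step `z` can be preceded by any neighbour of `v` except `z`. The
empty walk excludes none, hence `k` instead of `k - 1` above. -/
theorem sum_nbDartCount_reverse_succ {k : ℕ} (hreg : G.IsRegularOfDegree k) (i : ℕ) (v y : V) :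
    ∑ u with G.Adj v u, G.nbDartCount (i + 1) u v y = (k - 1) * G.nbCount (i + 1) v y := by
  have h1 : ∀ u ∈ univ.filter (G.Adj v), G.nbDartCount (i + 1) u v y =
      ∑ z, if z ≠ u then G.nbDartCount i v z y else 0 := by
    intro u hu
    have hu : G.Adj v u := by simpa using hu
    simp only [nbDartCount, hu.symm, if_true, Finset.sum_filter]
  rw [Finset.sum_congr rfl h1, Finset.sum_comm, nbCount, Finset.mul_sum]
  refine Finset.sum_congr rfl fun z _ => ?_
  by_cases hz : G.nbDartCount i v z y = 0
  · simp [hz]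
  · have hvz := adj_of_nbDartCount_ne_zero hz
    rw [← Finset.sum_filter, Finset.sum_const, smul_eq_mul]
    congr 1
    have : (univ.filter (G.Adj v)).filter (fun u => z ≠ u) = (G.neighborFinset v).erase z := by
      ext u
      simp [and_comm, eq_comm]
    rw [this, Finset.card_erase_of_mem (by simpa using hvz), card_neighborFinset_eq_degree, hreg v]

/-- A walk from a neighbour `u` of `v` either avoids `v` at its first step, so that prepending `v`
creates no backtracking, or starts with `u → v`. -/
theorem sum_nbCount_adj (i : ℕ) (v y : V) :
    ∑ u with G.Adj v u, G.nbCount (i + 1) u y =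
      G.nbCount (i + 2) v y + ∑ u with G.Adj v u, G.nbDartCount i u v y := by
  have h2 : G.nbCount (i + 2) v y =
      ∑ u with G.Adj v u, ∑ z with z ≠ v, G.nbDartCount i u z y := by
    simp only [nbCount, nbDartCount, Finset.sum_filter]
  rw [h2, ← Finset.sum_add_distrib]
  refine Finset.sum_congr rfl fun u _ => ?_
  rw [nbCount, Finset.filter_ne', Finset.sum_erase_add _ _ (Finset.mem_univ v)]

end NonBacktracking

/-! ### Non-backtracking counts as polynomials in the adjacency matrix. -/

/-- The polynomials in the adjacency matrix of a `k`-regular graph that count non-backtracking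
walks. -/
noncomputable def nbPoly (k : ℝ) : ℕ → ℝ[X]
  | 0 => 1
  | 1 => X
  | 2 => X * X - C k
  | i + 3 => X * nbPoly k (i + 2) - C (k - 1) * nbPoly k (i + 1)

section Adjacency

variable {V : Type*} [Fintype V] [DecidableEq V] {G : SimpleGraph V} [DecidableRel G.Adj]

theorem adjMatrix_mul_nbCount (i : ℕ) :
    G.adjMatrix ℝ * Matrix.of (fun u y => (G.nbCount (i + 1) u y : ℝ)) =
      Matrix.of (fun u y => (G.nbCount (i + 2) u y : ℝ)) +
      Matrix.of (fun v y => ((∑ u with G.Adj v u, G.nbDartCount i u v y : ℕ) : ℝ)) := by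
  ext v y
  rw [adjMatrix_mul_apply, Matrix.add_apply, Matrix.of_apply, Matrix.of_apply, ← Nat.cast_add,
    ← sum_nbCount_adj, neighborFinset_eq_filter]
  simp

theorem aeval_nbPoly {k : ℕ} (hreg : G.IsRegularOfDegree k) (hk : 1 ≤ k) (i : ℕ) :
    aeval (G.adjMatrix ℝ) (nbPoly k i) = Matrix.of (fun u y => (G.nbCount i u y : ℝ)) := by
  have h0 : (1 : Matrix V V ℝ) = Matrix.of (fun u y => (G.nbCount 0 u y : ℝ)) := by
    ext u y
    simp [nbCount, Matrix.one_apply]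
  have h1 : G.adjMatrix ℝ = Matrix.of (fun u y => (G.nbCount 1 u y : ℝ)) := by
    ext u y
    have : G.nbCount 1 u y = if G.Adj u y then 1 else 0 := by
      rw [nbCount, Finset.sum_eq_single y]
      · simp [nbDartCount]
      · intro v _ hv
        simp [nbDartCount, hv]
      · simp
    rw [Matrix.of_apply, this, adjMatrix_apply]
    simp
  induction i using Nat.strong_induction_on with
  | _ i ih =>
    match i, ih with
    | 0, _ => simpa [nbPoly] using h0
    | 1, _ => simpa [nbPoly] using h1
    | 2, _ =>
      have h := adjMatrix_mul_nbCount (G := G) 0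
      simp only [sum_nbDartCount_reverse_zero hreg, zero_add] at h
      rw [← h1] at h
      rw [nbPoly, map_sub, map_mul, aeval_X, aeval_C, h, sub_eq_iff_eq_add,
        Algebra.algebraMap_eq_smul_one, h0]
      congr 1
      ext u y
      simp
    | i + 3, ih =>
      have h := adjMatrix_mul_nbCount (G := G) (i + 1)
      simp only [sum_nbDartCount_reverse_succ hreg] at h
      rw [nbPoly, map_sub, map_mul, map_mul, aeval_X, aeval_C, ih (i + 2) (by omega),
        ih (i + 1) (by omega), h, sub_eq_iff_eq_add, ← Algebra.smul_def]
      congr 1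
      ext u y
      simp [Nat.cast_sub hk]

end Adjacency

/-! ### Orthogonal-polynomial identities, positivity and the cone. -/

section Polynomials

variable {k : ℝ}

theorem degree_nbPoly_and_monic (k : ℝ) (i : ℕ) :
    (nbPoly k i).degree = i ∧ (nbPoly k i).Monic := by
  induction i using Nat.strong_induction_on with
  | _ i ih =>
    match i, ih with
    | 0, _ => simp [nbPoly]
    | 1, _ => simp [nbPoly, monic_X]
    | 2, _ =>
      have hm : (X * X : ℝ[X]).Monic := monic_X.mul monic_X
      have hd : (X * X : ℝ[X]).degree = 2 := by rw [degree_mul, degree_X]; rfl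
      have hlt : (C k).degree < (X * X : ℝ[X]).degree :=
        lt_of_le_of_lt degree_C_le (by rw [hd]; decide)
      exact ⟨by rw [nbPoly, degree_sub_eq_left_of_degree_lt hlt, hd]; rfl,
        hm.sub_of_left hlt⟩
    | i + 3, ih =>
      obtain ⟨d2, m2⟩ := ih (i + 2) (by omega)
      obtain ⟨d1, m1⟩ := ih (i + 1) (by omega)
      have hd : (X * nbPoly k (i + 2)).degree = ((i + 3 : ℕ) : WithBot ℕ) := by
        rw [degree_mul, degree_X, d2]
        norm_cast
        omega
      have hlt : (C (k - 1) * nbPoly k (i + 1)).degree < (X * nbPoly k (i + 2)).degree := by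
        rw [hd]
        refine lt_of_le_of_lt ((degree_mul_le _ _).trans (add_le_add_left degree_C_le _)) ?_
        rw [d1, zero_add]
        exact_mod_cast (by omega : i + 1 < i + 3)
      exact ⟨by rw [nbPoly, degree_sub_eq_left_of_degree_lt hlt, hd],
        (monic_X.mul m2).sub_of_left hlt⟩

theorem degree_nbPoly (k : ℝ) (i : ℕ) : (nbPoly k i).degree = i := (degree_nbPoly_and_monic k i).1

theorem monic_nbPoly (k : ℝ) (i : ℕ) : (nbPoly k i).Monic := (degree_nbPoly_and_monic k i).2

theorem natDegree_nbPoly (k : ℝ) (i : ℕ) : (nbPoly k i).natDegree = i :=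
  natDegree_eq_of_degree_eq_some (degree_nbPoly k i)

theorem exists_eq_sum_nbPoly (k : ℝ) (m : ℕ) (f : ℝ[X]) (hf : f.degree < m) :
    ∃ c : ℕ → ℝ, f = ∑ i ∈ range m, C (c i) * nbPoly k i := by
  induction m generalizing f with
  | zero =>
    refine ⟨0, ?_⟩
    simpa [Nat.WithBot.lt_zero_iff] using hf
  | succ m ih =>
    obtain ⟨c, hc⟩ := ih (f - C (f.coeff m) * nbPoly k m) (by
      rw [degree_lt_iff_coeff_zero] at hf ⊢
      intro j hj
      rw [coeff_sub, coeff_C_mul]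
      rcases hj.eq_or_lt with rfl | hj
      · have := monic_nbPoly k m
        rw [Monic, leadingCoeff, natDegree_nbPoly] at this
        rw [this]; ring
      · have : (nbPoly k m).coeff j = 0 :=
          coeff_eq_zero_of_natDegree_lt (by rwa [natDegree_nbPoly])
        rw [hf j hj, this]; ring)
    refine ⟨Function.update c m (f.coeff m), ?_⟩
    rw [sum_range_succ, Function.update_self, ← sub_eq_iff_eq_add, hc]
    refine sum_congr rfl fun i hi => ?_
    rw [Function.update_of_ne (by simp at hi; omega)]

theorem eval_nbPoly_succ (k : ℝ) (i : ℕ) : (nbPoly k (i + 1)).eval k = k * (k - 1) ^ i := by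
  induction i using Nat.strong_induction_on with
  | _ i ih =>
    match i, ih with
    | 0, _ => simp [nbPoly]
    | 1, _ => simp [nbPoly]; ring
    | i + 2, ih =>
      have h1 := ih (i + 1) (by omega)
      have h2 := ih i (by omega)
      rw [nbPoly, eval_sub, eval_mul, eval_mul, eval_X, eval_C, h1, h2]
      ring

theorem eval_nbPoly_nonneg (hk : 1 ≤ k) (i : ℕ) : 0 ≤ (nbPoly k i).eval k := by
  cases i with
  | zero => simp [nbPoly]
  | succ i =>
    rw [eval_nbPoly_succ]
    have : 0 ≤ k - 1 := by linarith
    positivity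

/-- The partial sums of the polynomials `nbPoly k`. -/
noncomputable def nbSumPoly (k : ℝ) (m : ℕ) : ℝ[X] := ∑ i ∈ range (m + 1), nbPoly k i

theorem nbSumPoly_zero (k : ℝ) : nbSumPoly k 0 = 1 := by simp [nbSumPoly, nbPoly]

theorem nbSumPoly_succ (k : ℝ) (m : ℕ) :
    nbSumPoly k (m + 1) = nbSumPoly k m + nbPoly k (m + 1) := by
  rw [nbSumPoly, sum_range_succ, nbSumPoly]

theorem nbSumPoly_one (k : ℝ) : nbSumPoly k 1 = X + 1 := by
  rw [nbSumPoly_succ, nbSumPoly_zero, nbPoly, add_comm]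

/-- Unlike `nbPoly`, the partial sums satisfy one three-term recurrence from the start, as
Christoffel–Darboux requires. -/
theorem nbSumPoly_add_two (k : ℝ) (m : ℕ) :
    nbSumPoly k (m + 2) = X * nbSumPoly k (m + 1) - C (k - 1) * nbSumPoly k m := by
  induction m with
  | zero =>
    rw [nbSumPoly_succ, nbSumPoly_one, nbSumPoly_zero, nbPoly, C_sub, C_1]
    ring
  | succ m ih =>
    rw [nbSumPoly_succ k (m + 2), nbPoly]
    linear_combination ih - X * nbSumPoly_succ k (m + 1) + C (k - 1) * nbSumPoly_succ k m

theorem eval_nbSumPoly_pos (hk : 1 ≤ k) (m : ℕ) : 0 < (nbSumPoly k m).eval k := by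
  induction m with
  | zero => simp [nbSumPoly_zero]
  | succ m ih =>
    rw [nbSumPoly_succ, eval_add]
    exact add_pos_of_pos_of_nonneg ih (eval_nbPoly_nonneg hk _)

theorem eval_nbSumPoly_pos_of_forall_pos (hk : 1 ≤ k) (m : ℕ) (a t : ℝ)
    (h : ∀ y, t < y → y ≤ k → 0 < (nbSumPoly k (m + 1)).eval y - a * (nbSumPoly k m).eval y) :
    ∀ y, t < y → y ≤ k → 0 < (nbSumPoly k m).eval y := by
  induction m generalizing a t with
  | zero => simp [nbSumPoly_zero]
  | succ m ih =>
    intro y hty hyk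
    by_contra hy
    -- At the last point `r` where `nbSumPoly k (m + 1)` is nonpositive it vanishes, so the
    -- recurrence gives `nbSumPoly k (m + 2)` the value `-(k - 1) * nbSumPoly k m` there. Induction
    -- on `(r, k]` makes this nonpositive, against `h`.
    obtain ⟨r, hr, hmax⟩ : ∃ r,
        IsGreatest {z | z ∈ Set.Icc y k ∧ (nbSumPoly k (m + 1)).eval z ≤ 0} r := by
      refine IsCompact.exists_isGreatest ?_ ⟨y, ⟨le_rfl, hyk⟩, not_lt.1 hy⟩
      exact isCompact_Icc.inter_right
        (isClosed_le (nbSumPoly k (m + 1)).continuous continuous_const)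
    obtain ⟨⟨hyr, hrk⟩, hr0⟩ := hr
    have hpos : ∀ z, r < z → z ≤ k → 0 < (nbSumPoly k (m + 1)).eval z := fun z hz hzk => by
      by_contra hz0
      exact absurd (hmax ⟨⟨hyr.trans hz.le, hzk⟩, not_lt.1 hz0⟩) (not_le.2 hz)
    have hrk' : r < k := hrk.lt_of_ne fun h => by
      have := eval_nbSumPoly_pos hk (m + 1)
      rw [h] at hr0
      linarith
    have hpos' := ih 0 r fun z hz hzk => by simpa using hpos z hz hzk
    have hcl : r ∈ closure (Set.Ioc r k) := by
      rw [closure_Ioc hrk'.ne]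
      exact ⟨le_rfl, hrk⟩
    have nonneg_of : ∀ f : ℝ[X], (∀ z, r < z → z ≤ k → 0 < f.eval z) → 0 ≤ f.eval r := by
      intro f hf
      exact closure_minimal (s := Set.Ioc r k) (t := {z | 0 ≤ f.eval z})
        (fun z hz => (hf z hz.1 hz.2).le) (isClosed_le continuous_const f.continuous) hcl
    have h1 := nonneg_of _ hpos
    have h2 := nonneg_of _ hpos'
    have h3 := h r (hty.trans_le hyr) hrk
    have h4 : (nbSumPoly k (m + 1)).eval r = 0 := le_antisymm hr0 h1
    rw [nbSumPoly_add_two, eval_sub, eval_mul, eval_mul, eval_C, h4] at h3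
    have : 0 ≤ (k - 1) * (nbSumPoly k m).eval r := mul_nonneg (by linarith) h2
    linarith

theorem eval_nbSumPoly_nonneg_of_forall_pos (hk : 1 ≤ k) (m : ℕ) (a t : ℝ) (ht : t < k)
    (h : ∀ y, t < y → y ≤ k → 0 < (nbSumPoly k (m + 1)).eval y - a * (nbSumPoly k m).eval y)
    {i : ℕ} (hi : i ≤ m) : 0 ≤ (nbSumPoly k i).eval t := by
  have hpos : ∀ y, t < y → y ≤ k → 0 < (nbSumPoly k i).eval y := by
    induction hi using Nat.decreasingInduction with
    | self => exact eval_nbSumPoly_pos_of_forall_pos hk m a t h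
    | of_succ j _ ih =>
      exact eval_nbSumPoly_pos_of_forall_pos hk j 0 t fun y hy hyk => by simpa using ih y hy hyk
  have hcl : t ∈ closure (Set.Ioc t k) := by
    rw [closure_Ioc ht.ne]
    exact ⟨le_rfl, ht.le⟩
  exact closure_minimal (s := Set.Ioc t k) (t := {z | 0 ≤ (nbSumPoly k i).eval z})
    (fun z hz => (hpos z hz.1 hz.2).le)
    (isClosed_le continuous_const (nbSumPoly k i).continuous) hcl

/-- The Christoffel–Darboux kernel of the polynomials `nbSumPoly k`. -/
noncomputable def nbKernel (k t : ℝ) : ℕ → ℝ[X]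
  | 0 => 1
  | m + 1 => C (k - 1) * nbKernel k t m + C ((nbSumPoly k (m + 1)).eval t) * nbSumPoly k (m + 1)

/-- Unfolded, the kernel is the sum of `(k - 1) ^ (m - i) * S i (t) * S i` over `i ≤ m`, where `S =
nbSumPoly k`; the recurrence telescopes. -/
theorem sub_mul_nbKernel (k t : ℝ) (m : ℕ) :
    (X - C t) * nbKernel k t m = C ((nbSumPoly k m).eval t) * nbSumPoly k (m + 1) -
      C ((nbSumPoly k (m + 1)).eval t) * nbSumPoly k m := by
  induction m with
  | zero =>
    simp [nbKernel, nbSumPoly_zero, nbSumPoly_one]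
  | succ m ih =>
    rw [nbKernel, mul_add, mul_left_comm, ih, nbSumPoly_add_two, eval_sub, eval_mul, eval_mul,
      eval_X, eval_C]
    simp only [C_sub, C_mul]
    ring

theorem eval_nbKernel_pos (hk : 1 ≤ k) (t : ℝ) (m : ℕ)
    (h : ∀ i ≤ m, 0 ≤ (nbSumPoly k i).eval t) (hm : m = 0 ∨ 1 < k) :
    0 < (nbKernel k t m).eval k := by
  induction m with
  | zero => simp [nbKernel]
  | succ m ih =>
    have hk1 : 1 < k := by simpa using hm
    rw [nbKernel, eval_add, eval_mul, eval_mul, eval_C, eval_C]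
    refine add_pos_of_pos_of_nonneg (mul_pos (by linarith)
      (ih (fun i hi => h i (by omega)) (Or.inr hk1))) ?_
    exact mul_nonneg (h _ le_rfl) (eval_nbSumPoly_pos hk _).le

open scoped NNReal in
/-- The cone of nonnegative combinations of the first `m` polynomials `nbPoly k`. -/
noncomputable def nbCone (k : ℝ) (m : ℕ) : Submodule ℝ≥0 ℝ[X] :=
  Submodule.span ℝ≥0 (nbPoly k '' Set.Iio m)

theorem nbPoly_mem_nbCone (k : ℝ) {i m : ℕ} (h : i < m) : nbPoly k i ∈ nbCone k m :=
  Submodule.subset_span ⟨i, h, rfl⟩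

theorem nbCone_mono (k : ℝ) {m n : ℕ} (h : m ≤ n) : nbCone k m ≤ nbCone k n :=
  Submodule.span_mono (Set.image_mono (Set.Iio_subset_Iio h))

theorem nnreal_smul_eq_C_mul (c : NNReal) (p : ℝ[X]) : c • p = C (c : ℝ) * p := by
  ext j
  rw [coeff_smul, coeff_C_mul]
  rfl

theorem C_mul_mem_nbCone {m : ℕ} {a : ℝ} (ha : 0 ≤ a) {f : ℝ[X]} (hf : f ∈ nbCone k m) :
    C a * f ∈ nbCone k m := by
  exact nnreal_smul_eq_C_mul ⟨a, ha⟩ f ▸ (nbCone k m).smul_mem _ hf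

theorem nbSumPoly_mem_nbCone (k : ℝ) (m : ℕ) : nbSumPoly k m ∈ nbCone k (m + 1) :=
  Submodule.sum_mem _ fun _ hi => nbPoly_mem_nbCone k (mem_range.1 hi)

theorem nbKernel_mem_nbCone (hk : 1 ≤ k) (t : ℝ) (m : ℕ)
    (h : ∀ i ≤ m, 0 ≤ (nbSumPoly k i).eval t) : nbKernel k t m ∈ nbCone k (m + 1) := by
  induction m with
  | zero => exact nbPoly_mem_nbCone k zero_lt_one
  | succ m ih =>
    exact add_mem (C_mul_mem_nbCone (by linarith) (nbCone_mono k (by omega)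
      (ih fun i hi => h i (by omega)))) (C_mul_mem_nbCone (h _ le_rfl) (nbSumPoly_mem_nbCone k _))

end Polynomials

/-! ### Polynomials of a Hermitian matrix and their traces. -/

section Hermitian

variable {n : Type*} [Fintype n] [DecidableEq n] {A : Matrix n n ℝ}

theorem _root_.Matrix.IsHermitian.aeval_eq (hA : A.IsHermitian) (f : ℝ[X]) :
    aeval A f = Unitary.conjStarAlgAut ℝ _ hA.eigenvectorUnitary
      (diagonal fun i => f.eval (hA.eigenvalues i)) := by
  have h1 : aeval (diagonal hA.eigenvalues) f = diagonal fun i => f.eval (hA.eigenvalues i) := by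
    have := aeval_algHom_apply (diagonalAlgHom ℝ (n := n) (α := ℝ)) hA.eigenvalues f
    rw [diagonalAlgHom_apply] at this
    rw [this, diagonalAlgHom_apply]
    congr 1
    ext i
    simp
  have h2 := aeval_algHom_apply ((Unitary.conjStarAlgAut ℝ (Matrix n n ℝ)
    hA.eigenvectorUnitary).toAlgEquiv : Matrix n n ℝ →ₐ[ℝ] Matrix n n ℝ)
    (diagonal hA.eigenvalues) f
  rw [h1] at h2
  refine Eq.trans ?_ h2
  exact congrArg (fun B => aeval B f) hA.spectral_theorem

theorem _root_.Matrix.IsHermitian.trace_aeval (hA : A.IsHermitian) (f : ℝ[X]) :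
    (aeval A f).trace = ∑ i, f.eval (hA.eigenvalues i) := by
  rw [hA.aeval_eq, Unitary.conjStarAlgAut_apply, Matrix.trace_mul_cycle,
    Unitary.coe_star_mul_self, one_mul, trace_diagonal]

theorem _root_.Matrix.IsHermitian.aeval_eq_zero_iff (hA : A.IsHermitian) (f : ℝ[X]) :
    aeval A f = 0 ↔ ∀ i, f.eval (hA.eigenvalues i) = 0 := by
  rw [hA.aeval_eq, EmbeddingLike.map_eq_zero_iff, diagonal_eq_zero, funext_iff]
  rfl

theorem _root_.Matrix.trace_aeval_C_mul (A : Matrix n n ℝ) (c : ℝ) (p : ℝ[X]) :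
    (aeval A (C c * p)).trace = c * (aeval A p).trace := by
  rw [map_mul, aeval_C, ← Algebra.smul_def, trace_smul, smul_eq_mul]

theorem _root_.Matrix.IsSymm.aeval (hA : A.IsSymm) (f : ℝ[X]) :
    (Polynomial.aeval A f).IsSymm := by
  induction f using Polynomial.induction_on' with
  | add p q hp hq => rw [map_add]; exact hp.add hq
  | monomial i a =>
    rw [aeval_monomial, ← Algebra.smul_def]
    exact (hA.pow i).smul a

end Hermitian

/-! ### Spectra of regular graphs, trace comparison, Hoffman polynomial. -/

section Regular

variable {V : Type*} [Fintype V] [DecidableEq V] {G : SimpleGraph V} [DecidableRel G.Adj] {k : ℕ}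

theorem IsRegularOfDegree.aeval_adjMatrix_mulVec_one (hreg : G.IsRegularOfDegree k) (f : ℝ[X]) :
    aeval (G.adjMatrix ℝ) f *ᵥ 1 = fun _ => f.eval (k : ℝ) := by
  have hA : ∀ a : ℝ, G.adjMatrix ℝ *ᵥ (fun _ => a) = fun _ => k * a := fun a => by
    ext v
    exact adjMatrix_mulVec_const_apply_of_regular hreg
  induction f using Polynomial.induction_on with
  | C a =>
    ext v
    simp [Algebra.algebraMap_eq_smul_one, smul_mulVec]
  | add p q hp hq =>
    rw [map_add, add_mulVec, hp, hq]
    ext v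
    simp
  | monomial i a ih =>
    rw [pow_succ, ← mul_assoc, mul_comm, map_mul, aeval_X, ← mulVec_mulVec, ih, hA]
    ext v
    simp

theorem IsRegularOfDegree.lapMatrix_eq (hreg : G.IsRegularOfDegree k) :
    G.lapMatrix ℝ = (k : ℝ) • 1 - G.adjMatrix ℝ := by
  rw [lapMatrix, degMatrix]
  congr 1
  ext u v
  simp [diagonal_apply, one_apply, hreg u]

theorem IsRegularOfDegree.lapMatrix_mulVec_eigenvectorBasis (hreg : G.IsRegularOfDegree k) (i : V) :
    G.lapMatrix ℝ *ᵥ ⇑((G.isHermitian_adjMatrix ℝ).eigenvectorBasis i) =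
      (k - (G.isHermitian_adjMatrix ℝ).eigenvalues i) •
        ⇑((G.isHermitian_adjMatrix ℝ).eigenvectorBasis i) := by
  rw [hreg.lapMatrix_eq, sub_mulVec, smul_mulVec, one_mulVec,
    (G.isHermitian_adjMatrix ℝ).mulVec_eigenvectorBasis, sub_smul]

theorem IsRegularOfDegree.eigenvalues_le (hreg : G.IsRegularOfDegree k) (i : V) :
    (G.isHermitian_adjMatrix ℝ).eigenvalues i ≤ k := by
  set v := (G.isHermitian_adjMatrix ℝ).eigenvectorBasis i with hv
  have h1 := (posSemidef_lapMatrix ℝ G).dotProduct_mulVec_nonneg ⇑v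
  rw [hv, hreg.lapMatrix_mulVec_eigenvectorBasis, ← hv, dotProduct_smul, smul_eq_mul,
    star_trivial] at h1
  have h2 : (0 : ℝ) < ⇑v ⬝ᵥ ⇑v := by
    have hne : (⇑v : V → ℝ) ≠ 0 := fun h =>
      (G.isHermitian_adjMatrix ℝ).eigenvectorBasis.orthonormal.ne_zero i
        ((WithLp.ofLp_eq_zero 2).1 h)
    have := (dotProduct_star_self_pos_iff (v := (⇑v : V → ℝ))).2 hne
    simpa using this
  have := nonneg_of_mul_nonneg_left h1 h2
  linarith

/-- The product of all `X - λ` annihilates the matrix, and its row sums are its value at `k`. -/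
theorem IsRegularOfDegree.exists_eigenvalues_eq [Nonempty V] (hreg : G.IsRegularOfDegree k) :
    ∃ i, (G.isHermitian_adjMatrix ℝ).eigenvalues i = k := by
  have h := hreg.aeval_adjMatrix_mulVec_one
    (∏ i, (X - C ((G.isHermitian_adjMatrix ℝ).eigenvalues i)))
  rw [((G.isHermitian_adjMatrix ℝ).aeval_eq_zero_iff _).2, zero_mulVec] at h
  · have := congrFun h (Classical.arbitrary V)
    rw [eval_prod, Pi.zero_apply] at this
    obtain ⟨i, -, hi⟩ := Finset.prod_eq_zero_iff.1 this.symm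
    refine ⟨i, ?_⟩
    rw [eval_sub, eval_X, eval_C] at hi
    linarith
  · intro i
    rw [eval_prod]
    exact Finset.prod_eq_zero (Finset.mem_univ i) (by simp)

/-- In a regular graph, one eigenvalue is the degree and the others are at most the second-largest
eigenvalue, which is attained at another index. -/
theorem IsRegularOfDegree.exists_eigenvalues_index [Nontrivial V] (hreg : G.IsRegularOfDegree k) :
    ∃ i₀ i₁ : V, i₀ ≠ i₁ ∧ (G.isHermitian_adjMatrix ℝ).eigenvalues i₀ = k ∧
      (G.isHermitian_adjMatrix ℝ).eigenvalues i₁ = G.secondLargestEigenvalue ∧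
      ∀ i ≠ i₀, (G.isHermitian_adjMatrix ℝ).eigenvalues i ≤ G.secondLargestEigenvalue := by
  set hA := G.isHermitian_adjMatrix ℝ with hAdef
  let e : Fin (Fintype.card V) ≃ V := Fintype.equivOfCardEq (Fintype.card_fin _)
  have he : ∀ j, hA.eigenvalues (e j) = hA.eigenvalues₀ j := fun j =>
    congrArg hA.eigenvalues₀ (e.symm_apply_apply j)
  have hc : 1 < Fintype.card V := Fintype.one_lt_card
  refine ⟨e ⟨0, by omega⟩, e ⟨1, hc⟩, ?_, ?_, he _, ?_⟩
  · intro h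
    have := congrArg Fin.val (e.injective h)
    simp at this
  · apply le_antisymm (hreg.eigenvalues_le _)
    obtain ⟨i, hi⟩ := hreg.exists_eigenvalues_eq
    rw [← hi, he]
    exact hA.eigenvalues₀_antitone (Fin.mk_le_of_le_val (Nat.zero_le _))
  · intro i hi
    obtain ⟨j, rfl⟩ := e.surjective i
    rw [he]
    refine hA.eigenvalues₀_antitone ?_
    rw [Fin.le_def]
    have : j.val ≠ 0 := fun h => hi (congrArg e (Fin.ext h))
    change 1 ≤ j.val
    omega

/-- Eigenvectors for `k` lie in the Laplacian kernel, hence are constant by connectedness; two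
nonzero constant vectors are not orthogonal. -/
theorem IsRegularOfDegree.secondLargestEigenvalue_lt [Nontrivial V] (hreg : G.IsRegularOfDegree k)
    (hconn : G.Connected) : G.secondLargestEigenvalue < k := by
  obtain ⟨i₀, i₁, hne, h0, h1, -⟩ := hreg.exists_eigenvalues_index
  refine lt_of_le_of_ne (h1 ▸ hreg.eigenvalues_le i₁) fun h => ?_
  have hconst : ∀ i, (G.isHermitian_adjMatrix ℝ).eigenvalues i = k →
      ∃ a : ℝ, ∀ u, (G.isHermitian_adjMatrix ℝ).eigenvectorBasis i u = a := by
    intro i hi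
    have hL := hreg.lapMatrix_mulVec_eigenvectorBasis i
    rw [hi, sub_self, zero_smul, lapMatrix_mulVec_eq_zero_iff_forall_reachable] at hL
    exact ⟨_, fun u => hL u (Classical.arbitrary V) (hconn.preconnected _ _)⟩
  obtain ⟨a, ha⟩ := hconst i₀ h0
  obtain ⟨b, hb⟩ := hconst i₁ (h1.trans h)
  have horth := (G.isHermitian_adjMatrix ℝ).eigenvectorBasis.orthonormal
  have hab : inner ℝ ((G.isHermitian_adjMatrix ℝ).eigenvectorBasis i₀)
      ((G.isHermitian_adjMatrix ℝ).eigenvectorBasis i₁) = 0 := horth.2 hne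
  rw [PiLp.inner_apply] at hab
  simp only [ha, hb] at hab
  have hzero : ∀ i, (∀ u, (G.isHermitian_adjMatrix ℝ).eigenvectorBasis i u = 0) → False :=
    fun i hi => horth.ne_zero i (by ext u; exact hi u)
  have : a = 0 ∨ b = 0 := by simpa [or_comm] using hab
  rcases this with rfl | rfl
  · exact hzero _ ha
  · exact hzero _ hb

theorem IsRegularOfDegree.sum_nbCount (hreg : G.IsRegularOfDegree k) (hk : 1 ≤ k) (i : ℕ) (u : V) :
    ∑ y, (G.nbCount i u y : ℝ) = (nbPoly k i).eval (k : ℝ) := by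
  have := congrFun (hreg.aeval_adjMatrix_mulVec_one (nbPoly k i)) u
  rw [aeval_nbPoly hreg hk] at this
  simpa [mulVec, dotProduct] using this

theorem IsRegularOfDegree.trace_aeval_nbPoly_mul (hreg : G.IsRegularOfDegree k) (hk : 1 ≤ k)
    (i j : ℕ) : (aeval (G.adjMatrix ℝ) (nbPoly k i * nbPoly k j)).trace =
      ∑ u, ∑ y, (G.nbCount i u y : ℝ) * G.nbCount j u y := by
  have hs := IsSymm.aeval (G.isSymm_adjMatrix (α := ℝ)) (nbPoly k j)
  rw [map_mul, Matrix.trace]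
  refine Finset.sum_congr rfl fun u _ => ?_
  rw [diag_apply, mul_apply]
  refine Finset.sum_congr rfl fun y _ => ?_
  rw [← hs.apply y u, aeval_nbPoly hreg hk, aeval_nbPoly hreg hk]
  rfl

/-- In a regular graph `G` of large girth, traces of nonnegative combinations of products
`nbPoly k i * nbPoly k j` are at most those in any regular graph of the same order and degree. -/
theorem IsRegularOfDegree.trace_aeval_mul_le {W : Type*} [Fintype W] [DecidableEq W]
    {H : SimpleGraph W} [DecidableRel H.Adj] (hreg : G.IsRegularOfDegree k)
    (hregH : H.IsRegularOfDegree k) (hcard : Fintype.card W = Fintype.card V) (hk : 1 ≤ k) {d : ℕ}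
    (hg : ((2 * d : ℕ) : ℕ∞) ≤ G.egirth) {f g : ℝ[X]} (hf : f ∈ nbCone k (d + 1))
    (hg' : g ∈ nbCone k d) :
    (aeval (G.adjMatrix ℝ) (f * g)).trace ≤ (aeval (H.adjMatrix ℝ) (f * g)).trace := by
  have hlt : ∀ {m : ℕ}, m < 2 * d → (m : ℕ∞) < G.egirth := fun h =>
    (Nat.cast_lt.2 h).trans_le hg
  have basis : ∀ i < d + 1, ∀ j < d,
      (aeval (G.adjMatrix ℝ) (nbPoly k i * nbPoly k j)).trace ≤
        (aeval (H.adjMatrix ℝ) (nbPoly k i * nbPoly k j)).trace := by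
    intro i hi j hj
    rw [hreg.trace_aeval_nbPoly_mul hk, hregH.trace_aeval_nbPoly_mul hk]
    -- For `i = j`, counts in `G` are 0 or 1 and equal their squares; in `H` they are at most their
    -- squares, and the totals agree by regularity. For `i ≠ j`, the supports in `G` are disjoint
    -- because `i + j < 2 * d`.
    rcases eq_or_ne i j with rfl | hij
    · calc ∑ u, ∑ y, (G.nbCount i u y : ℝ) * G.nbCount i u y
          = ∑ u : V, ∑ y, (G.nbCount i u y : ℝ) := by
            refine Finset.sum_congr rfl fun u _ => Finset.sum_congr rfl fun y _ => ?_
            have := nbCount_le_one_of_lt_egirth (G := G) (hlt (by omega : 2 * i < 2 * d)) u y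
            interval_cases G.nbCount i u y <;> simp
        _ = ∑ u : W, ∑ y, (H.nbCount i u y : ℝ) := by
            simp [hreg.sum_nbCount hk, hregH.sum_nbCount hk, hcard]
        _ ≤ _ := by
            refine Finset.sum_le_sum fun u _ => Finset.sum_le_sum fun y _ => ?_
            exact_mod_cast Nat.le_mul_self _
    · calc ∑ u, ∑ y, (G.nbCount i u y : ℝ) * G.nbCount j u y = 0 := by
            refine Finset.sum_eq_zero fun u _ => Finset.sum_eq_zero fun y _ => ?_
            by_cases h : G.nbCount i u y = 0
            · simp [h]
            · simp [nbCount_eq_zero_of_ne_of_lt_egirth hij (hlt (by omega)) h]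
        _ ≤ _ := by positivity
  induction hf using Submodule.span_induction with
  | zero => simp
  | add p q _ _ hp hq => simpa only [add_mul, map_add, trace_add] using add_le_add hp hq
  | smul c p _ hp =>
    rw [nnreal_smul_eq_C_mul, mul_assoc, trace_aeval_C_mul, trace_aeval_C_mul]
    exact mul_le_mul_of_nonneg_left hp c.2
  | mem p hp =>
    obtain ⟨i, hi, rfl⟩ := hp
    induction hg' using Submodule.span_induction with
    | zero => simp
    | add p q _ _ hp hq => simpa only [mul_add, map_add, trace_add] using add_le_add hp hq
    | smul c p _ hp =>
      rw [nnreal_smul_eq_C_mul, mul_left_comm, trace_aeval_C_mul, trace_aeval_C_mul]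
      exact mul_le_mul_of_nonneg_left hp c.2
    | mem p hp =>
      obtain ⟨j, hj, rfl⟩ := hp
      exact basis i hi j hj

/-- Hoffman polynomial: if `p` vanishes at all eigenvalues other than the degree, then all entries
of `p` at the adjacency matrix of a connected regular graph are equal. -/
theorem IsRegularOfDegree.card_mul_aeval_apply (hreg : G.IsRegularOfDegree k)
    (hconn : G.Connected) {p : ℝ[X]}
    (hp : ∀ i, (G.isHermitian_adjMatrix ℝ).eigenvalues i ≠ k →
      p.eval ((G.isHermitian_adjMatrix ℝ).eigenvalues i) = 0) (u v : V) :
    Fintype.card V * aeval (G.adjMatrix ℝ) p u v = p.eval (k : ℝ) := by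
  set M := aeval (G.adjMatrix ℝ) p with hM
  have hLM : G.lapMatrix ℝ * M = 0 := by
    have h : aeval (G.adjMatrix ℝ) ((C (k : ℝ) - X) * p) = 0 := by
      rw [(G.isHermitian_adjMatrix ℝ).aeval_eq_zero_iff]
      intro i
      rw [eval_mul, eval_sub, eval_C, eval_X]
      by_cases hi : (G.isHermitian_adjMatrix ℝ).eigenvalues i = k
      · rw [hi]; ring
      · rw [hp i hi, mul_zero]
    rwa [map_mul, map_sub, aeval_C, aeval_X, Algebra.algebraMap_eq_smul_one,
      ← hreg.lapMatrix_eq] at h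
  have hrow : ∀ a b y, M a y = M b y := by
    intro a b y
    have h : G.lapMatrix ℝ *ᵥ (M.col y) = 0 := by
      ext x
      exact congrFun (congrFun hLM x) y
    exact lapMatrix_mulVec_eq_zero_iff_forall_reachable G |>.1 h a b (hconn.preconnected a b)
  have hs : M.IsSymm := IsSymm.aeval (G.isSymm_adjMatrix (α := ℝ)) p
  have hall : ∀ y, M u y = M u v := fun y => by
    rw [hrow u y y, hrow y v y, ← hs.apply v y, hrow y u v]
  have := congrFun (hreg.aeval_adjMatrix_mulVec_one p) u
  rw [← this, ← hM]
  simp [mulVec, dotProduct, hall]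

end Regular

/-! ### The extremal polynomial and the final comparison. -/

section Extremal

variable {V : Type*} [Fintype V] [DecidableEq V] {G : SimpleGraph V} [DecidableRel G.Adj] {k d : ℕ}

/-- Zero row sums would kill the nonnegative matrix of counts, yet a polynomial of degree `i` cannot
vanish at more than `i` eigenvalues. -/
theorem IsRegularOfDegree.eval_nbPoly_ne_zero (hreg : G.IsRegularOfDegree k) (hk : 1 ≤ k)
    {S : Finset ℝ} (hS : ∀ x ∈ S, ∃ i, (G.isHermitian_adjMatrix ℝ).eigenvalues i = x)
    {i : ℕ} (hi : i < S.card) : (nbPoly k i).eval (k : ℝ) ≠ 0 := by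
  intro h0
  have hz : aeval (G.adjMatrix ℝ) (nbPoly k i) = 0 := by
    rw [aeval_nbPoly hreg hk]
    ext u y
    have := hreg.sum_nbCount hk i u
    rw [h0, Finset.sum_eq_zero_iff_of_nonneg fun _ _ => Nat.cast_nonneg _] at this
    exact this y (Finset.mem_univ y)
  rw [(G.isHermitian_adjMatrix ℝ).aeval_eq_zero_iff] at hz
  have hsub : S.val ⊆ (nbPoly k i).roots := fun x hx => by
    obtain ⟨j, rfl⟩ := hS x hx
    exact (mem_roots (monic_nbPoly _ _).ne_zero).2 (hz j)
  have := card_le_degree_of_subset_roots hsub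
  rw [natDegree_nbPoly] at this
  omega

/-- If the girth of a connected regular graph is at least `2 * d`, then the monic polynomial of
degree `d` vanishing at the eigenvalues other than the degree is `nbPoly k d` plus a constant
multiple of `nbSumPoly k (d - 1)`. -/
theorem IsRegularOfDegree.eq_nbPoly_add_nbSumPoly (hreg : G.IsRegularOfDegree k) (hk : 1 ≤ k)
    (hconn : G.Connected) {m : ℕ} (hg : ((2 * (m + 1) : ℕ) : ℕ∞) ≤ G.egirth)
    {p : ℝ[X]} (hmonic : p.Monic) (hdeg : p.natDegree = m + 1)
    (hp : ∀ i, (G.isHermitian_adjMatrix ℝ).eigenvalues i ≠ k →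
      p.eval ((G.isHermitian_adjMatrix ℝ).eigenvalues i) = 0)
    (hne : ∀ i ≤ m, (nbPoly k i).eval (k : ℝ) ≠ 0) :
    p = nbPoly k (m + 1) + C (p.eval (k : ℝ) / Fintype.card V) * nbSumPoly k m := by
  have hdeg' : p.degree = (m + 1 : ℕ) := by rw [degree_eq_natDegree hmonic.ne_zero, hdeg]
  obtain ⟨c, hc⟩ := exists_eq_sum_nbPoly k (m + 1) (p - nbPoly k (m + 1)) (by
    rw [← hdeg']
    exact degree_sub_lt_left (by rw [hdeg', degree_nbPoly]) hmonic.ne_zero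
      (by rw [hmonic.leadingCoeff, (monic_nbPoly _ _).leadingCoeff]))
  have hpsum : p = nbPoly k (m + 1) + ∑ i ∈ range (m + 1), C (c i) * nbPoly k i := by
    rw [← hc]; ring
  obtain ⟨u⟩ := hconn.nonempty
  have hci : ∀ i ∈ range (m + 1), c i = p.eval (k : ℝ) / Fintype.card V := by
    intro i hi
    have hi : i < m + 1 := Finset.mem_range.1 hi
    -- For `y` at the end of a non-backtracking walk of length `i` from `u`, only `nbPoly k i`
    -- contributes to entry `(u, y)`, so that entry of the matrix of `p` is `c i`. By Hoffman it
    -- does not depend on `i`.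
    obtain ⟨y, -, hy⟩ := Finset.exists_ne_zero_of_sum_ne_zero
      (ne_of_eq_of_ne (hreg.sum_nbCount hk i u) (hne i (by omega)))
    have hy : G.nbCount i u y ≠ 0 := by exact_mod_cast hy
    have hlt : ∀ {j : ℕ}, j < 2 * (m + 1) → (j : ℕ∞) < G.egirth := fun h =>
      (Nat.cast_lt.2 h).trans_le hg
    have h1 : G.nbCount i u y = 1 :=
      le_antisymm (nbCount_le_one_of_lt_egirth (hlt (by omega)) u y) (Nat.one_le_iff_ne_zero.2 hy)
    have hval : aeval (G.adjMatrix ℝ) p u y = c i := by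
      rw [hpsum, map_add, map_sum, aeval_nbPoly hreg hk, Matrix.add_apply, Matrix.of_apply,
        nbCount_eq_zero_of_ne_of_lt_egirth (by omega) (hlt (by omega)) hy, Matrix.sum_apply,
        Finset.sum_eq_single i]
      · rw [map_mul, aeval_C, ← Algebra.smul_def, aeval_nbPoly hreg hk]
        simp [h1]
      · intro j hj hji
        have hj := Finset.mem_range.1 hj
        rw [map_mul, aeval_C, ← Algebra.smul_def, aeval_nbPoly hreg hk]
        simp [nbCount_eq_zero_of_ne_of_lt_egirth hji.symm (hlt (by omega)) hy]
      · intro h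
        exact absurd (Finset.mem_range.2 hi) h
    have := hreg.card_mul_aeval_apply hconn hp u y
    rw [hval] at this
    have hcard : (Fintype.card V : ℝ) ≠ 0 := by
      have : Nonempty V := ⟨u⟩
      exact_mod_cast Fintype.card_ne_zero
    rw [← this]
    field_simp
  conv_lhs => rw [hpsum]
  rw [nbSumPoly, Finset.mul_sum]
  congr 1
  exact Finset.sum_congr rfl fun i hi => by rw [hci i hi]

theorem IsRegularOfDegree.secondLargestEigenvalue_le [Nontrivial V]
    (hreg : G.IsRegularOfDegree k) (hconn : G.Connected)
    (hd : (spectrum ℝ (G.adjMatrix ℝ)).ncard = d + 1) (hg : ((2 * d : ℕ) : ℕ∞) ≤ G.egirth)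
    {W : Type*} [Fintype W] [DecidableEq W] [Nontrivial W] {H : SimpleGraph W}
    [DecidableRel H.Adj] (hcard : Fintype.card W = Fintype.card V)
    (hregH : H.IsRegularOfDegree k) :
    G.secondLargestEigenvalue ≤ H.secondLargestEigenvalue := by
  set hA := G.isHermitian_adjMatrix ℝ with hAdef
  obtain ⟨i₀, i₁, hne, h0, h1, hle⟩ := hreg.exists_eigenvalues_index
  have htk := hreg.secondLargestEigenvalue_lt hconn
  set t := G.secondLargestEigenvalue with ht
  have hk : 1 ≤ k := by
    have := hconn.preconnected.minDegree_pos_of_nontrivial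
    rw [hreg.minDegree_eq] at this
    exact this
  have hk' : (1 : ℝ) ≤ k := by exact_mod_cast hk
  classical
  set S : Finset ℝ := Finset.univ.image hA.eigenvalues with hSdef
  have hmem : ∀ i, hA.eigenvalues i ∈ S := fun i => Finset.mem_image_of_mem _ (Finset.mem_univ i)
  have hSex : ∀ x ∈ S, ∃ i, hA.eigenvalues i = x := fun x hx => by simpa [hSdef] using hx
  have hScard : S.card = d + 1 := by
    rw [← hd, hA.spectrum_real_eq_range_eigenvalues, ← Set.ncard_coe_finset]
    simp [hSdef]
  have hkS : (k : ℝ) ∈ S := h0 ▸ hmem i₀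
  have htS : t ∈ S.erase (k : ℝ) := Finset.mem_erase.2 ⟨htk.ne, h1 ▸ hmem i₁⟩
  have hSle : ∀ x ∈ S.erase (k : ℝ), x ≤ t := by
    intro x hx
    obtain ⟨hxk, hxS⟩ := Finset.mem_erase.1 hx
    obtain ⟨i, rfl⟩ := hSex x hxS
    exact hle i fun h => hxk (h ▸ h0)
  set q : ℝ[X] := ∏ x ∈ (S.erase (k : ℝ)).erase t, (X - C x) with hq
  set p : ℝ[X] := (X - C t) * q with hpq
  have hp : p = ∏ x ∈ S.erase (k : ℝ), (X - C x) := Finset.mul_prod_erase _ _ htS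
  obtain ⟨m, rfl⟩ : ∃ m, d = m + 1 := by
    have := Finset.card_pos.2 ⟨t, htS⟩
    rw [Finset.card_erase_of_mem hkS, hScard] at this
    exact ⟨d - 1, by omega⟩
  have hpmonic : p.Monic := hp ▸ monic_prod_of_monic _ _ fun x _ => monic_X_sub_C x
  have hpdeg : p.natDegree = m + 1 := by
    rw [hp, natDegree_prod_of_monic _ _ fun x _ => monic_X_sub_C x]
    simp [Finset.card_erase_of_mem hkS, hScard]
  have hppos : ∀ y, t < y → 0 < p.eval y := by
    intro y hy
    rw [hp, eval_prod]
    refine Finset.prod_pos fun x hx => ?_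
    have := hSle x hx
    simp only [eval_sub, eval_X, eval_C]
    linarith
  have hpvan : ∀ i, hA.eigenvalues i ≠ k → p.eval (hA.eigenvalues i) = 0 := by
    intro i hi
    rw [hp, eval_prod]
    exact Finset.prod_eq_zero (Finset.mem_erase.2 ⟨hi, hmem i⟩) (by simp)
  have hFne : ∀ i ≤ m + 1, (nbPoly k i).eval (k : ℝ) ≠ 0 := fun i hi =>
    hreg.eval_nbPoly_ne_zero hk hSex (by omega)
  set c : ℝ := p.eval (k : ℝ) / Fintype.card V with hc
  have hc0 : 0 ≤ c := div_nonneg (hppos _ htk).le (Nat.cast_nonneg _)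
  have hpF : p = nbPoly k (m + 1) + C c * nbSumPoly k m :=
    hreg.eq_nbPoly_add_nbSumPoly hk hconn hg hpmonic hpdeg hpvan fun i hi => hFne i (by omega)
  have hpG : p = nbSumPoly k (m + 1) - C (1 - c) * nbSumPoly k m := by
    rw [hpF, nbSumPoly_succ, C_sub, C_1]
    ring
  have hGnonneg : ∀ i ≤ m, 0 ≤ (nbSumPoly k i).eval t := fun i hi => by
    refine eval_nbSumPoly_nonneg_of_forall_pos hk' m (1 - c) t htk (fun y hy _ => ?_) hi
    have := hppos y hy
    rwa [hpG, eval_sub, eval_mul, eval_C] at this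
  -- Since `p` vanishes at `t`, the right side of Christoffel–Darboux is a multiple of `p`;
  -- cancelling `X - C t` identifies the kernel with a multiple of `q`.
  have hker : (X - C t) * nbKernel k t m = (X - C t) * (C ((nbSumPoly k m).eval t) * q) := by
    have hpt : (nbSumPoly k (m + 1)).eval t = (1 - c) * (nbSumPoly k m).eval t := by
      have : p.eval t = 0 := by simp [hpq]
      rw [hpG, eval_sub, eval_mul, eval_C] at this
      linarith
    rw [sub_mul_nbKernel, hpt, mul_left_comm, ← hpq, hpG, C_mul]
    ring
  replace hker := mul_left_cancel₀ (X_sub_C_ne_zero t) hker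
  set s : ℝ := (nbSumPoly k m).eval t with hs
  have hs0 : s ≠ 0 := by
    intro h
    have hpos := eval_nbKernel_pos hk' t m hGnonneg (by
      rcases m.eq_zero_or_pos with hm | hm
      · exact Or.inl hm
      -- If `k = 1`, then `nbPoly k 2` vanishes at `k`, which `hFne` forbids.
      · refine Or.inr (lt_of_le_of_ne hk' fun h => hFne 2 (by omega) ?_)
        rw [eval_nbPoly_succ, ← h]
        ring)
    rw [hker, h] at hpos
    simp at hpos
  have hqcone : q ∈ nbCone (k : ℝ) (m + 1) := by
    have : q = C s⁻¹ * nbKernel k t m := by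
      rw [hker, ← mul_assoc, ← C_mul, inv_mul_cancel₀ hs0, C_1, one_mul]
    rw [this]
    exact C_mul_mem_nbCone (inv_nonneg.2 (hGnonneg m le_rfl)) (nbKernel_mem_nbCone hk' t m hGnonneg)
  have hpcone : p ∈ nbCone (k : ℝ) (m + 2) := by
    rw [hpF]
    exact add_mem (nbPoly_mem_nbCone _ (by omega))
      (nbCone_mono _ (by omega) (C_mul_mem_nbCone hc0 (nbSumPoly_mem_nbCone _ m)))
  by_contra! hlt
  obtain ⟨j₀, j₁, -, hj0, -, hjle⟩ := hregH.exists_eigenvalues_index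
  set r := H.secondLargestEigenvalue with hr
  -- Adding `(t - r) * q` turns the factor `X - t` of `p` into `X - r`.
  have hcone : p + C (t - r) * q ∈ nbCone (k : ℝ) (m + 2) :=
    add_mem hpcone (C_mul_mem_nbCone (by linarith) (nbCone_mono _ (by omega) hqcone))
  have htrace := hreg.trace_aeval_mul_le hregH hcard hk hg hcone hqcone
  rw [hA.trace_aeval, (H.isHermitian_adjMatrix ℝ).trace_aeval] at htrace
  have hf : ∀ x, ((p + C (t - r) * q) * q).eval x = (x - r) * q.eval x ^ 2 := by
    intro x
    simp only [hpq, eval_mul, eval_add, eval_sub, eval_C, eval_X]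
    ring
  simp only [hf] at htrace
  have hqt : 0 < q.eval t ^ 2 := by
    refine pow_pos ?_ 2
    rw [hq, eval_prod]
    refine Finset.prod_pos fun x hx => ?_
    obtain ⟨hxt, hx⟩ := Finset.mem_erase.1 hx
    have := lt_of_le_of_ne (hSle x hx) hxt
    simp only [eval_sub, eval_X, eval_C]
    linarith
  -- Eigenvalues other than `k` and `t` are roots of `q`; further copies of `k` or `t` only add
  -- nonnegative terms.
  have hlower : (k - r) * q.eval (k : ℝ) ^ 2 + (t - r) * q.eval t ^ 2 ≤
      ∑ i, (hA.eigenvalues i - r) * q.eval (hA.eigenvalues i) ^ 2 := by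
    have hsum := Finset.sum_le_sum_of_subset_of_nonneg (Finset.subset_univ {i₀, i₁})
      (f := fun i => (hA.eigenvalues i - r) * q.eval (hA.eigenvalues i) ^ 2) fun i _ _ => by
        by_cases hik : hA.eigenvalues i = k
        · exact mul_nonneg (by rw [hik]; linarith) (sq_nonneg _)
        by_cases hit : hA.eigenvalues i = t
        · exact mul_nonneg (by rw [hit]; linarith) (sq_nonneg _)
        · have : q.eval (hA.eigenvalues i) = 0 := by
            rw [hq, eval_prod]
            exact Finset.prod_eq_zero (Finset.mem_erase.2 ⟨hit, Finset.mem_erase.2 ⟨hik, hmem i⟩⟩)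
              (by simp)
          simp [this]
    rwa [Finset.sum_pair hne, h0, h1] at hsum
  have hupper : ∑ j, ((H.isHermitian_adjMatrix ℝ).eigenvalues j - r) *
      q.eval ((H.isHermitian_adjMatrix ℝ).eigenvalues j) ^ 2 ≤ (k - r) * q.eval (k : ℝ) ^ 2 := by
    rw [← Finset.add_sum_erase _ _ (Finset.mem_univ j₀), hj0, add_le_iff_nonpos_right]
    refine Finset.sum_nonpos fun j hj => mul_nonpos_of_nonpos_of_nonneg ?_ (sq_nonneg _)
    linarith [hjle j (Finset.ne_of_mem_erase hj)]
  have : 0 < (t - r) * q.eval t ^ 2 := mul_pos (by linarith) hqt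
  linarith

end Extremal

end SimpleGraph

theorem mainTheorem1 {V : Type u} [Fintype V] [DecidableEq V] [Nontrivial V]
    (G : SimpleGraph V) [DecidableRel G.Adj] (k d : ℕ)
    (hconn : G.Connected) (hreg : G.IsRegularOfDegree k)
    (hd : (spectrum ℝ (G.adjMatrix ℝ)).ncard = d + 1)
    (hg : ((2 * d : ℕ) : ℕ∞) ≤ G.egirth) :
    SimpleGraph.IsExtremalExpander.{u, w} G k :=
  ⟨hreg, fun _ _ _ _ _ _ hcard hregH => hreg.secondLargestEigenvalue_le hconn hd hg hcard hregH⟩
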